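/- For a finite simple graph $G$ let $q(G)$ denote its $Q$-index, that is, the largest eigenvalue of the signless Laplacian matrix $Q(G)=D(G)+A(G)$, where $A(G)$ is the adjacency matrix of $G$ and $D(G)$ is the diagonal matrix of its vertex degrees. For $n\ge k$ let $S_{n,k}=K_k\vee\overline{K}_{n-k}$ be the graph of order $n$ obtained by joining each vertex of a complete graph of order $k$ to each vertex of an independent set of order $n-k$. Let $k\ge 3$ and $n\ge 110k^2$ be integers, and let $G$ be a graph of order $n$ that does not contain the cycle $C_{2k+1}$ of length $2k+1$ as a (not necessarily induced) subgraph. Then $q(G)<q(S_{n,k})$, unless $G$ is isomorphic to $S_{n,k}$. -/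

import Mathlib

/-- The signless Laplacian `Q(G) = D(G) + A(G)` of a finite simple graph, as a real matrix. -/
def SimpleGraph.signlessLapMatrix {V : Type*} [Fintype V] [DecidableEq V]
    (G : SimpleGraph V) [DecidableRel G.Adj] : Matrix V V ℝ :=
  G.degMatrix ℝ + G.adjMatrix ℝ

open scoped Classical in
/-- The `Q`-index `q(G)`: the largest eigenvalue of the signless Laplacian of `G`. -/
noncomputable def SimpleGraph.qIndex {V : Type*} [Fintype V] (G : SimpleGraph V) : ℝ :=
  sSup (spectrum ℝ G.signlessLapMatrix)

open scoped Classical in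
/-- For a nonempty vertex set the supremum in `qIndex` is attained: `qIndex` is a maximum. -/
theorem SimpleGraph.isGreatest_qIndex {V : Type*} [Fintype V] [Nonempty V]
    (G : SimpleGraph V) : IsGreatest (spectrum ℝ G.signlessLapMatrix) G.qIndex := by
  have hQ : G.signlessLapMatrix.IsHermitian :=
    (G.isHermitian_degMatrix ℝ).add (G.isHermitian_adjMatrix ℝ)
  have hs := hQ.spectrum_real_eq_range_eigenvalues
  have hfin : (spectrum ℝ G.signlessLapMatrix).Finite := by
    rw [hs]; exact Set.finite_range _
  have hne : (spectrum ℝ G.signlessLapMatrix).Nonempty := by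
    rw [hs]; exact Set.range_nonempty _
  exact ⟨hne.csSup_mem hfin, fun _ hx => le_csSup hfin.bddAbove hx⟩

/-- The join `G ∨ H`: the disjoint union of `G` and `H` together with all edges between them. -/
def SimpleGraph.joinGraph {V W : Type*} (G : SimpleGraph V) (H : SimpleGraph W) :
    SimpleGraph (V ⊕ W) :=
  G.sum H ⊔ completeBipartiteGraph V W

/-- `S_{n,k}`: the join of the complete graph of order `k` and the edgeless graph of
order `n - k`, a graph of order `n` for `k ≤ n`. -/
def completeSplitGraph (n k : ℕ) : SimpleGraph (Fin k ⊕ Fin (n - k)) :=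
  SimpleGraph.joinGraph (⊤ : SimpleGraph (Fin k)) (⊥ : SimpleGraph (Fin (n - k)))

/-!
Let `q₀` be the larger root of `t² - (n + 2k - 2) t + 2k (k - 1)`. It is an eigenvalue of the
signless Laplacian of `S_{n,k}`, and `q₀ = n + 2k - 2 - e` with `n e ≤ 2k (k - 1)`, so that `e ≤ 1 / 55`.
Suppose that `G` has no `C_{2k+1}` and `q = q(G) ≥ q₀`. The absolute value `x` of an eigenvector,
scaled to maximum `1`, satisfies `q x ≤ Q x` entrywise (`exists_subinvariant`), and nothing else
about it is needed.

A vertex `u` maximizing `x u / d(u)` satisfies Merris's inequality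
`q d(u) ≤ d(u)² + ∑_{w ~ u} d(w)`. Let `A` be the neighbourhood of `u` and `B` the set of its
non-neighbours. As `G` has no `C_{2k+1}`, the set `A` induces no path on `2k` vertices, so the
Erdős–Gallai theorem (`sum_degree_within_le_of_no_path`) bounds the average degree inside `A` by
`2k - 2`. Merris's inequality then leaves a total slack of only `e d(u)`: the average degree inside
`A` is almost `2k - 2`, and at most `e d(u)` pairs between `A` and `B` are non-adjacent.

If `|B| ≥ k - 1`, an edge inside `A` extends to a `C_{2k+1}` that alternates between `A` and
`B ∪ {u}` (`cycleGraph_isContained_of_many_nonneighbors`). If `|B| ≤ k - 2`, let `L` be the set of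
vertices of degree more than `n / 2 + k`. It contains `u` and `B`. Each vertex off `L` has entry at
most `2 S / n`, where `S = ∑ x`, and the degrees off `L` add up to `O(k n)`; so
`q S ≤ 2 ∑ d(v) x v` shows that `L` carries almost half of `S ≥ 2k - e`, that is, at least
`k - 1/10`. Any two vertices of `L` have more than `2k` common neighbours, which turns a further
vertex in `L` into a `C_{2k+1}`, whence `|L| = k`. An edge outside of `L` must have ends
adjacent to no vertex of `L` but `u`; then the other vertices of `L` miss a vertex, and their
entries are too small (`exists_cover_of_few_nonneighbors`). So all edges of `G` meet `L`.

Finally `x` is paired with the positive eigenvector of `S_{n,k}` for `q₀`: since `x` is positive on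
`L`, the inequality `q ≥ q₀` forces every vertex of `L` to be dominating
(`dominating_of_subinvariant`), and `G` is `S_{n,k}`.
-/

namespace SimpleGraph

/-! ### Cycles and paths given by lists of vertices -/

/-- A list of distinct vertices, consecutive ones adjacent and the last adjacent to the first,
is a copy of a cycle. -/
theorem cycleGraph_isContained_of_isChain {V : Type*} {G : SimpleGraph V} {l : List V}
    (hnd : l.Nodup) (hc : l.IsChain G.Adj)
    (hclose : ∀ a ∈ l.getLast?, ∀ b ∈ l.head?, G.Adj a b) :
    cycleGraph l.length ⊑ G := by
  have key : ∀ i j : Fin l.length, (i - j).val = 1 → G.Adj l[i] l[j] := by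
    intro i j hij
    rw [Fin.val_sub] at hij
    have hi := i.isLt
    have hj := j.isLt
    rcases le_or_gt j.val i.val with h | h
    · have h1 : l.length - j.val + i.val = (i.val - j.val) + l.length := by omega
      rw [h1, Nat.add_mod_right, Nat.mod_eq_of_lt (by omega)] at hij
      have h2 := (List.isChain_iff_getElem.1 hc) j.val (by omega)
      have h3 : i.val = j.val + 1 := by omega
      simp only [Fin.getElem_fin, h3]
      exact h2.symm
    · rw [Nat.mod_eq_of_lt (by omega)] at hij
      have h1 : i.val = 0 := by omega
      have h2 : j.val = l.length - 1 := by omega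
      refine (hclose _ ?_ _ ?_).symm
      · simp only [Fin.getElem_fin, h2]
        rw [List.getLast?_eq_getElem?]
        simp only [Option.mem_def]
        exact List.getElem?_eq_getElem (by omega)
      · simp only [Fin.getElem_fin, h1]
        rw [List.head?_eq_getElem?]
        simp only [Option.mem_def]
        exact List.getElem?_eq_getElem (by omega)
  refine ⟨⟨⟨fun i => l[i], fun {i j} hij => ?_⟩, ?_⟩⟩
  · rcases cycleGraph_adj'.1 hij with h | h
    · exact key i j h
    · exact (key j i h).symm
  · intro i j hij
    exact Fin.ext ((List.Nodup.getElem_inj_iff hnd).1 hij)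

/-- If any two of the vertices of `h :: t` have at least `|t|` common neighbours in a pool `P`
that avoids them, then these vertices are visited, in this order, by a path that alternates
between them and the pool. -/
theorem exists_alternating_path {V : Type*} [DecidableEq V] (G : SimpleGraph V)
    [DecidableRel G.Adj] (t : List V) : ∀ (h : V) (P : Finset V), (h :: t).Nodup →
    (∀ a ∈ h :: t, a ∉ P) →
    (∀ a ∈ h :: t, ∀ b ∈ h :: t, a ≠ b → t.length ≤ {w ∈ P | G.Adj a w ∧ G.Adj b w}.card) →
    ∃ l : List V, l.Nodup ∧ l.IsChain G.Adj ∧ l.length = 2 * t.length + 1 ∧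
      l.head? = some h ∧ l.getLast? = (h :: t).getLast? ∧ ∀ x ∈ l, x ∈ h :: t ∨ x ∈ P := by
  induction t with
  | nil => intro h P _ _ _; exact ⟨[h], by simp⟩
  | cons h' t ih =>
    intro h P hnd hP hcom
    have hne : h ≠ h' := by rintro rfl; simp at hnd
    have hpos : 0 < {w ∈ P | G.Adj h w ∧ G.Adj h' w}.card :=
      lt_of_lt_of_le (by simp) (hcom h (by simp) h' (by simp) hne)
    obtain ⟨i, hi⟩ := Finset.card_pos.1 hpos
    rw [Finset.mem_filter] at hi
    obtain ⟨l, l1, l2, l3, l4, l5, l6⟩ := ih h' (P.erase i) (List.nodup_cons.1 hnd).2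
      (fun a ha ha' => hP a (List.mem_cons_of_mem _ ha) (Finset.mem_of_mem_erase ha'))
      (fun a ha b hb hab => by
        have h1 := hcom a (List.mem_cons_of_mem _ ha) b (List.mem_cons_of_mem _ hb) hab
        rw [Finset.filter_erase]
        have h2 := Finset.pred_card_le_card_erase (s := {w ∈ P | G.Adj a w ∧ G.Adj b w}) (a := i)
        simp only [List.length_cons] at h1
        omega)
    have hil : i ∉ l := by
      intro hil
      rcases l6 i hil with h1 | h1
      · exact hP i (List.mem_cons_of_mem _ h1) hi.1
      · simp at h1
    have hhl : h ∉ l := by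
      intro hil
      rcases l6 h hil with h1 | h1
      · exact (List.nodup_cons.1 hnd).1 h1
      · exact hP h (by simp) (Finset.mem_of_mem_erase h1)
    refine ⟨h :: i :: l, ?_, ?_, ?_, rfl, ?_, ?_⟩
    · simp only [List.nodup_cons, List.mem_cons, not_or]
      exact ⟨⟨hi.2.1.ne, hhl⟩, hil, l1⟩
    · refine List.IsChain.cons_cons hi.2.1 (l2.cons fun y hy => ?_)
      rw [l4, Option.mem_some_iff] at hy
      exact hy ▸ hi.2.2.symm
    · simp only [List.length_cons, l3]; ring
    · cases l with
      | nil => simp at l4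
      | cons x l => simpa [List.getLast?_cons_cons] using l5
    · intro x hx
      simp only [List.mem_cons] at hx
      rcases hx with rfl | rfl | hx
      · simp
      · exact Or.inr hi.1
      · rcases l6 x hx with h1 | h1
        · exact Or.inl (List.mem_cons_of_mem _ h1)
        · exact Or.inr (Finset.mem_of_mem_erase h1)

/-- An alternating path on `k = |t| + 1` hubs, closed up by an edge `r r'` outside of it that joins
its two ends, is a cycle of length `2k + 1`. -/
theorem cycleGraph_isContained_of_hubs {V : Type*} [DecidableEq V] (G : SimpleGraph V)
    [DecidableRel G.Adj] {t : List V} {h c r r' : V} {P : Finset V} (hnd : (h :: t).Nodup)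
    (hP : ∀ a ∈ h :: t, a ∉ P)
    (hcom : ∀ a ∈ h :: t, ∀ b ∈ h :: t, a ≠ b →
      t.length ≤ {w ∈ P | G.Adj a w ∧ G.Adj b w}.card)
    (hlast : (h :: t).getLast? = some c) (hr : r ∉ h :: t) (hr' : r' ∉ h :: t) (hrP : r ∉ P)
    (hrP' : r' ∉ P) (hrh : G.Adj r h) (hrc : G.Adj r' c) (hrr : G.Adj r r') :
    cycleGraph (2 * (t.length + 1) + 1) ⊑ G := by
  obtain ⟨l, l1, l2, l3, l4, l5, l6⟩ := exists_alternating_path G t h P hnd hP hcom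
  have hrl : r ∉ l := fun hx => (l6 r hx).elim hr hrP
  have hrl' : r' ∉ l := fun hx => (l6 r' hx).elim hr' hrP'
  have hlen : (r :: (l ++ [r'])).length = 2 * (t.length + 1) + 1 := by
    simp [l3]; ring
  rw [← hlen]
  apply cycleGraph_isContained_of_isChain
  · simp only [List.nodup_cons, List.mem_append, List.mem_singleton, not_or]
    refine ⟨⟨hrl, hrr.ne⟩, ?_⟩
    rw [List.nodup_append]
    refine ⟨l1, by simp, ?_⟩
    intro a ha b hb
    rw [List.mem_singleton] at hb
    subst hb
    exact fun hab => hrl' (hab ▸ ha)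
  · refine List.IsChain.cons (l2.append (by simp) ?_) ?_
    · intro x hx y hy
      rw [l5, hlast] at hx
      simp only [Option.mem_def, Option.some.injEq, List.head?_cons] at hx hy
      subst hx hy
      exact hrc.symm
    · intro y hy
      rw [List.head?_append, l4] at hy
      simp only [Option.mem_def, Option.some_or, Option.some.injEq] at hy
      exact hy ▸ hrh
  · intro a ha b hb
    rw [← List.cons_append] at ha
    simp only [List.getLast?_append, List.getLast?_singleton, Option.mem_def, Option.some_or,
      Option.some.injEq, List.head?_cons] at ha hb
    subst ha hb
    exact hrr.symm

/-! ### The Erdős–Gallai bound for a path of even order -/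

/-- Pósa's rotation argument: a path within `A` on fewer than `2k` vertices, whose ends have all
their neighbours in `A` on the path and at least `k` of them, can be reordered into a closed
one. -/
theorem exists_perm_closed_of_path {V : Type*} [DecidableEq V] (G : SimpleGraph V)
    [DecidableRel G.Adj] {k : ℕ} {A : Finset V} {l : List V} {a b : V} (hnd : l.Nodup)
    (hc : l.IsChain G.Adj) (hlen : l.length < 2 * k) (ha : l.head? = some a)
    (hb : l.getLast? = some b)
    (hka : k ≤ {w ∈ A | G.Adj a w}.card) (hkb : k ≤ {w ∈ A | G.Adj b w}.card)
    (hla : ∀ w ∈ A, G.Adj a w → w ∈ l) (hlb : ∀ w ∈ A, G.Adj b w → w ∈ l) :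
    ∃ c : List V, c.Perm l ∧ c.IsChain G.Adj ∧
      ∀ x ∈ c.getLast?, ∀ y ∈ c.head?, G.Adj x y := by
  have hpos : 0 < l.length := by
    cases l with
    | nil => simp at ha
    | cons x l => simp
  have ha0 : l[0] = a := by
    rw [List.head?_eq_getElem?, List.getElem?_eq_getElem hpos] at ha
    exact Option.some.inj ha
  have hb0 : l[l.length - 1] = b := by
    rw [List.getLast?_eq_getElem?, List.getElem?_eq_getElem (by omega)] at hb
    exact Option.some.inj hb
  set S₁ : Finset ℕ := {i ∈ Finset.range (l.length - 1) | G.Adj a (l.getD (i + 1) a)} with hS₁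
  set S₂ : Finset ℕ := {i ∈ Finset.range (l.length - 1) | G.Adj b (l.getD i a)} with hS₂
  have h1 : k ≤ S₁.card := by
    refine hka.trans ((Finset.card_le_card ?_).trans
      (Finset.card_image_le (s := S₁) (f := fun i => l.getD (i + 1) a)))
    intro w hw
    rw [Finset.mem_filter] at hw
    obtain ⟨j, hj, hjw⟩ := List.mem_iff_getElem.1 (hla w hw.1 hw.2)
    have hj0 : j ≠ 0 := by
      rintro rfl
      exact hw.2.ne (ha0.symm.trans hjw)
    have hj1 : j - 1 + 1 = j := by omega
    have hval : l.getD (j - 1 + 1) a = w := by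
      rw [hj1, List.getD_eq_getElem _ _ hj, hjw]
    refine Finset.mem_image.2 ⟨j - 1, ?_, hval⟩
    rw [hS₁, Finset.mem_filter, Finset.mem_range, hval]
    exact ⟨by omega, hw.2⟩
  have h2 : k ≤ S₂.card := by
    refine hkb.trans ((Finset.card_le_card ?_).trans
      (Finset.card_image_le (s := S₂) (f := fun i => l.getD i a)))
    intro w hw
    rw [Finset.mem_filter] at hw
    obtain ⟨j, hj, hjw⟩ := List.mem_iff_getElem.1 (hlb w hw.1 hw.2)
    have hj0 : j ≠ l.length - 1 := by
      rintro rfl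
      exact hw.2.ne (hb0.symm.trans hjw)
    have hval : l.getD j a = w := by
      rw [List.getD_eq_getElem _ _ hj, hjw]
    refine Finset.mem_image.2 ⟨j, ?_, hval⟩
    rw [hS₂, Finset.mem_filter, Finset.mem_range, hval]
    exact ⟨by omega, hw.2⟩
  have hint : (S₁ ∩ S₂).Nonempty := by
    rw [← Finset.card_pos]
    have h3 := Finset.card_union_add_card_inter S₁ S₂
    have h4 : (S₁ ∪ S₂).card ≤ l.length - 1 := by
      rw [← Finset.card_range (l.length - 1)]
      exact Finset.card_le_card (Finset.union_subset (Finset.filter_subset _ _)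
        (Finset.filter_subset _ _))
    omega
  obtain ⟨i, hi⟩ := hint
  rw [Finset.mem_inter, hS₁, hS₂, Finset.mem_filter, Finset.mem_filter, Finset.mem_range] at hi
  obtain ⟨⟨hi0, hi1⟩, -, hi2⟩ := hi
  rw [List.getD_eq_getElem _ _ (by omega)] at hi1 hi2
  have hsplit : l.take (i + 1) ++ l.drop (i + 1) = l := List.take_append_drop _ _
  have hdrop : (l.drop (i + 1)).head? = some l[i + 1] := by
    rw [List.head?_drop, List.getElem?_eq_getElem (by omega)]
  have hdl : (l.drop (i + 1)).getLast? = some b := by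
    rw [List.getLast?_drop, hb, if_neg (by omega)]
  have htl : (l.take (i + 1)).getLast? = some l[i] := by
    rw [List.getLast?_take, if_neg (by omega)]
    simp [List.getElem?_eq_getElem (show i < l.length by omega)]
  have hth : (l.take (i + 1)).head? = some a := by
    rw [List.head?_take, if_neg (by omega), ha]
  refine ⟨l.take (i + 1) ++ (l.drop (i + 1)).reverse, ?_, ?_, ?_⟩
  · conv_rhs => rw [← hsplit]
    exact (List.reverse_perm _).append_left _
  · refine (hc.take _).append ?_ ?_
    · rw [List.isChain_reverse]
      exact (hc.drop _).imp fun _ _ h => h.symm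
    · intro x hx y hy
      rw [htl] at hx
      rw [List.head?_reverse, hdl] at hy
      simp only [Option.mem_def, Option.some.injEq] at hx hy
      subst hx hy
      exact hi2.symm
  · intro x hx y hy
    rw [List.getLast?_append, List.getLast?_reverse, hdrop] at hx
    rw [List.head?_append, hth] at hy
    simp only [Option.mem_def, Option.some_or, Option.some.injEq] at hx hy
    subst hx hy
    exact hi1.symm

/-- A vertex adjacent to a vertex of a closed path starts a path through it and all vertices of
the closed one. -/
theorem exists_path_of_closed {V : Type*} {G : SimpleGraph V} {c : List V} {x z : V}
    (hc : c.IsChain G.Adj) (hclose : ∀ x ∈ c.getLast?, ∀ y ∈ c.head?, G.Adj x y) (hx : x ∈ c)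
    (hz : G.Adj z x) : ∃ l : List V, l.Perm c ∧ (z :: l).IsChain G.Adj := by
  obtain ⟨s, t, rfl⟩ := List.append_of_mem hx
  refine ⟨(x :: t) ++ s, List.perm_append_comm, ?_⟩
  obtain ⟨h1, h2, -⟩ := List.isChain_append.1 hc
  refine (h2.append h1 fun a ha b hb => hclose a ?_ b ?_).cons ?_
  · rw [List.getLast?_append]
    simp only [Option.mem_def] at ha ⊢
    rw [ha]; rfl
  · rw [List.head?_append]
    simp only [Option.mem_def] at hb ⊢
    rw [hb]; rfl
  · intro y hy
    simp only [List.cons_append, List.head?_cons, Option.mem_def, Option.some.injEq] at hy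
    exact hy ▸ hz

/-- The Erdős–Gallai bound: a vertex set that induces no path on `2k` vertices induces a subgraph
of average degree at most `2k - 2`. -/
theorem sum_degree_within_le_of_no_path {V : Type*} [DecidableEq V] (G : SimpleGraph V)
    [DecidableRel G.Adj] {k : ℕ} (hk : 1 ≤ k) (A : Finset V)
    (hA : ∀ l : List V, l.Nodup → l.IsChain G.Adj → (∀ x ∈ l, x ∈ A) → l.length ≠ 2 * k) :
    ∑ a ∈ A, {w ∈ A | G.Adj a w}.card ≤ (2 * k - 2) * A.card := by
  induction A using Finset.strongInduction with
  | H A ih =>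
  have hsub : ∀ B ⊂ A, ∑ a ∈ B, {w ∈ B | G.Adj a w}.card ≤ (2 * k - 2) * B.card :=
    fun B hB => ih B hB fun l h1 h2 h3 => hA l h1 h2 fun x hx => hB.1 (h3 x hx)
  by_cases hlow : ∃ a ∈ A, {w ∈ A | G.Adj a w}.card < k
  · obtain ⟨a, haA, ha⟩ := hlow
    have h1 := hsub (A.erase a) (Finset.erase_ssubset haA)
    have hmem : a ∉ A.erase a := Finset.notMem_erase a A
    have h2 : ∑ v ∈ A, {w ∈ A | G.Adj v w}.card =
        2 * {w ∈ A | G.Adj a w}.card +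
          ∑ v ∈ A.erase a, {w ∈ A.erase a | G.Adj v w}.card := by
      have h3 : {w ∈ A | G.Adj a w} = {w ∈ A.erase a | G.Adj a w} := by
        ext w
        simp only [Finset.mem_filter, Finset.mem_erase]
        exact ⟨fun h => ⟨⟨h.2.ne', h.1⟩, h.2⟩, fun h => ⟨h.1.2, h.2⟩⟩
      have h4 : ∀ v ∈ A.erase a, {w ∈ A | G.Adj v w}.card =
          (if G.Adj a v then 1 else 0) + {w ∈ A.erase a | G.Adj v w}.card := by
        intro v _
        conv_lhs => rw [← Finset.insert_erase haA]
        rw [Finset.filter_insert]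
        by_cases hva : G.Adj v a
        · rw [if_pos hva, if_pos hva.symm, Finset.card_insert_of_notMem (by simp), add_comm]
        · rw [if_neg hva, if_neg (fun h => hva h.symm), zero_add]
      rw [← Finset.add_sum_erase A _ haA, Finset.sum_congr rfl h4, Finset.sum_add_distrib,
        Finset.sum_boole, h3]
      simp only [Nat.cast_id]
      ring
    have h5 := Finset.card_erase_add_one haA
    have h6 : (2 * k - 2) * A.card = (2 * k - 2) * (A.erase a).card + (2 * k - 2) := by
      rw [← h5]; ring
    omega
  · push Not at hlow
    rcases A.eq_empty_or_nonempty with rfl | ⟨a₀, ha₀⟩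
    · simp
    -- a longest path within `A`; it has fewer than `2k` vertices
    let Q : ℕ → Prop := fun m =>
      ∃ l : List V, l.Nodup ∧ l.IsChain G.Adj ∧ (∀ x ∈ l, x ∈ A) ∧ l.length = m
    have hQ : ∀ m, Q m → m < 2 * k := by
      rintro m ⟨l, h1, h2, h3, rfl⟩
      by_contra! hle
      exact hA (l.take (2 * k)) (h1.sublist (List.take_sublist _ _)) (h2.take _)
        (fun x hx => h3 x (List.mem_of_mem_take hx)) (by rw [List.length_take]; omega)
    have hQ1 : Q 1 := ⟨[a₀], by simp, by simp, by simpa using ha₀, rfl⟩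
    classical
    obtain ⟨l, h1, h2, h3, h4⟩ : Q (Nat.findGreatest Q (2 * k)) :=
      Nat.findGreatest_spec (hQ 1 hQ1).le hQ1
    have hmax : ∀ l' : List V, l'.Nodup → l'.IsChain G.Adj → (∀ x ∈ l', x ∈ A) →
        l'.length ≤ l.length := by
      intro l' g1 g2 g3
      rw [h4]
      exact Nat.le_findGreatest (hQ _ ⟨l', g1, g2, g3, rfl⟩).le ⟨l', g1, g2, g3, rfl⟩
    have hlk : l.length < 2 * k := hQ _ ⟨l, h1, h2, h3, rfl⟩
    have hl1 : 1 ≤ l.length := hmax [a₀] (by simp) (by simp) (by simpa using ha₀)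
    have hne : l ≠ [] := by rintro rfl; simp at hl1
    have hend : ∀ l' : List V, l'.Perm l → l'.IsChain G.Adj → ∀ a ∈ l'.head?,
        ∀ w ∈ A, G.Adj a w → w ∈ l := by
      intro l' hp hch a ha w hw haw
      by_contra hwl
      have := hmax (w :: l') (List.nodup_cons.2 ⟨fun h => hwl (hp.mem_iff.1 h), hp.nodup_iff.2 h1⟩)
        (hch.cons fun y hy => by
          rw [Option.mem_def] at ha hy
          rw [ha] at hy
          exact (Option.some.inj hy) ▸ haw.symm)
        (fun x hx => by
          rcases List.mem_cons.1 hx with rfl | hx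
          · exact hw
          · exact h3 x (hp.mem_iff.1 hx))
      rw [List.length_cons, hp.length_eq] at this
      omega
    obtain ⟨c, hcp, hcc, hcl⟩ := exists_perm_closed_of_path G (A := A) h1 h2 hlk
      (List.head?_eq_some_head hne) (List.getLast?_eq_some_getLast hne)
      (hlow _ (h3 _ (List.head_mem hne))) (hlow _ (h3 _ (List.getLast_mem hne)))
      (hend l (List.Perm.refl l) h2 _ (List.head?_eq_some_head hne))
      (hend l.reverse (List.reverse_perm l)
        (List.isChain_reverse.2 (h2.imp fun _ _ h => h.symm)) _
        (by rw [List.head?_reverse]; exact List.getLast?_eq_some_getLast hne))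
    -- by maximality the closed path spans a component of the subgraph induced by `A`
    have hcomp : ∀ x ∈ l, ∀ z ∈ A, G.Adj z x → z ∈ l := by
      intro x hx z hz hzx
      by_contra hzl
      obtain ⟨l', hp, hch⟩ := exists_path_of_closed hcc hcl (hcp.mem_iff.2 hx) hzx
      have hpl := hp.trans hcp
      have := hmax (z :: l') (List.nodup_cons.2 ⟨fun h => hzl (hpl.mem_iff.1 h), hpl.nodup_iff.2 h1⟩)
        hch (fun y hy => by
          rcases List.mem_cons.1 hy with rfl | hy
          · exact hz
          · exact h3 y (hpl.mem_iff.1 hy))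
      rw [List.length_cons, hpl.length_eq] at this
      omega
    set C : Finset V := l.toFinset with hC
    have hCA : C ⊆ A := fun x hx => h3 x (List.mem_toFinset.1 hx)
    have hCcard : C.card = l.length := List.toFinset_card_of_nodup h1
    have hBA : A \ C ⊂ A := Finset.sdiff_ssubset hCA
      ⟨l.head hne, List.mem_toFinset.2 (List.head_mem hne)⟩
    have g1 := hsub _ hBA
    have g2 : ∑ a ∈ A \ C, {w ∈ A | G.Adj a w}.card =
        ∑ a ∈ A \ C, {w ∈ A \ C | G.Adj a w}.card := by
      refine Finset.sum_congr rfl fun a ha => congrArg _ ?_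
      ext w
      simp only [Finset.mem_filter, Finset.mem_sdiff] at ha ⊢
      refine ⟨fun h => ⟨⟨h.1, fun hw => ha.2 ?_⟩, h.2⟩, fun h => ⟨h.1.1, h.2⟩⟩
      exact List.mem_toFinset.2 (hcomp w (List.mem_toFinset.1 hw) a ha.1 h.2)
    have g3 : ∑ a ∈ C, {w ∈ A | G.Adj a w}.card ≤ C.card * (2 * k - 2) := by
      refine Finset.sum_le_card_nsmul _ _ _ fun a ha => ?_
      have : {w ∈ A | G.Adj a w} ⊆ C.erase a := by
        intro w hw
        rw [Finset.mem_filter] at hw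
        exact Finset.mem_erase.2 ⟨hw.2.ne', List.mem_toFinset.2
          (hcomp a (List.mem_toFinset.1 ha) w hw.1 hw.2.symm)⟩
      have h5 := Finset.card_le_card this
      rw [Finset.card_erase_of_mem ha] at h5
      omega
    rw [← Finset.sum_sdiff hCA, g2]
    have g4 := Finset.card_sdiff_add_card_eq_card hCA
    calc _ ≤ (2 * k - 2) * (A \ C).card + C.card * (2 * k - 2) := add_le_add g1 g3
      _ = _ := by rw [← g4]; ring

/-! ### The signless Laplacian -/

theorem signlessLapMatrix_mulVec_apply {V : Type*} [Fintype V] [DecidableEq V]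
    (G : SimpleGraph V) [DecidableRel G.Adj] (x : V → ℝ) (v : V) :
    (G.signlessLapMatrix.mulVec x) v = G.degree v * x v + ∑ w ∈ G.neighborFinset v, x w := by
  rw [signlessLapMatrix, Matrix.add_mulVec, Pi.add_apply, degMatrix_mulVec_apply,
    adjMatrix_mulVec_apply]

theorem degree_mul_add_sum_neighborFinset {V : Type*} [Fintype V]
    (G : SimpleGraph V) [DecidableRel G.Adj] (x : V → ℝ) (v : V) :
    G.degree v * x v + ∑ w ∈ G.neighborFinset v, x w =
      ∑ w, if G.Adj v w then x v + x w else 0 := by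
  rw [← Finset.sum_filter, ← neighborFinset_eq_filter, Finset.sum_add_distrib, Finset.sum_const,
    card_neighborFinset_eq_degree, nsmul_eq_mul]

open scoped Classical in
/-- The absolute value of an eigenvector for a nonnegative `Q`-index, scaled to have maximum `1`,
is subinvariant under the signless Laplacian. -/
theorem exists_subinvariant {V : Type*} [Fintype V] [Nonempty V] (G : SimpleGraph V)
    (hq : 0 ≤ G.qIndex) :
    ∃ x : V → ℝ, (∀ v, 0 ≤ x v) ∧ (∀ v, x v ≤ 1) ∧ (∃ v, x v = 1) ∧
      ∀ v, G.qIndex * x v ≤ G.degree v * x v + ∑ w ∈ G.neighborFinset v, x w := by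
  have hmem := G.isGreatest_qIndex.1
  rw [← Matrix.spectrum_toLin', ← Module.End.hasEigenvalue_iff_mem_spectrum] at hmem
  obtain ⟨z, hz⟩ := hmem.exists_hasEigenvector
  have hz1 : ∀ v, G.degree v * z v + ∑ w ∈ G.neighborFinset v, z w = G.qIndex * z v := by
    intro v
    have := congrFun hz.apply_eq_smul v
    rwa [Matrix.toLin'_apply, signlessLapMatrix_mulVec_apply] at this
  obtain ⟨u, -, hu⟩ := Finset.exists_max_image Finset.univ (fun v => |z v|)
    Finset.univ_nonempty
  have hupos : 0 < |z u| := by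
    obtain ⟨v, hv⟩ := Function.ne_iff.1 hz.2
    exact (abs_pos.2 hv).trans_le (hu v (Finset.mem_univ v))
  refine ⟨fun v => |z v| / |z u|, fun v => by positivity,
    fun v => div_le_one_of_le₀ (hu v (Finset.mem_univ v)) hupos.le,
    ⟨u, div_self hupos.ne'⟩, fun v => ?_⟩
  have h : G.qIndex * |z v| ≤ G.degree v * |z v| + ∑ w ∈ G.neighborFinset v, |z w| := by
    calc G.qIndex * |z v| = |G.degree v * z v + ∑ w ∈ G.neighborFinset v, z w| := by
          rw [hz1, abs_mul, abs_of_nonneg hq]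
      _ ≤ |G.degree v * z v| + |∑ w ∈ G.neighborFinset v, z w| := abs_add_le _ _
      _ ≤ _ := by
          rw [abs_mul, Nat.abs_cast]
          gcongr
          exact Finset.abs_sum_le_sum_abs _ _
  rw [← Finset.sum_div, ← mul_div_assoc, ← mul_div_assoc, ← add_div]
  gcongr

open scoped Classical in
theorem le_qIndex_of_eigenvector {V : Type*} [Fintype V] [Nonempty V] (G : SimpleGraph V)
    {q : ℝ} {x : V → ℝ} (h : ∀ v, ∑ w, (if G.Adj v w then x v + x w else 0) = q * x v)
    (hx : x ≠ 0) : q ≤ G.qIndex := by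
  refine G.isGreatest_qIndex.2 ?_
  rw [← Matrix.spectrum_toLin', ← Module.End.hasEigenvalue_iff_mem_spectrum]
  refine Module.End.hasEigenvalue_of_hasEigenvector (x := x)
    (Module.End.hasEigenvector_iff.2 ⟨Module.End.mem_eigenspace_iff.2 ?_, hx⟩)
  ext v
  rw [Matrix.toLin'_apply, signlessLapMatrix_mulVec_apply, degree_mul_add_sum_neighborFinset, h]
  rfl

/-- A vertex `u` that maximizes `x u / d(u)` satisfies Merris's inequality
`q ≤ d(u) + m(u)`, where `m(u)` is the average degree of the neighbours of `u`. -/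
theorem exists_merris_vertex {V : Type*} [Fintype V] (G : SimpleGraph V) [DecidableRel G.Adj]
    {q : ℝ} {x : V → ℝ} (hq : 0 < q) (hx : ∀ v, 0 ≤ x v) (hx1 : ∃ v, 0 < x v)
    (hsub : ∀ v, q * x v ≤ G.degree v * x v + ∑ w ∈ G.neighborFinset v, x w) :
    ∃ u, 0 < G.degree u ∧
      q * G.degree u ≤ G.degree u * G.degree u + ∑ w ∈ G.neighborFinset u, (G.degree w : ℝ) := by
  obtain ⟨v₀, hv₀⟩ := hx1
  have hdeg : ∀ v, 0 < x v → 0 < G.degree v := by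
    intro v hv
    by_contra! h0
    have h1 : G.degree v = 0 := by omega
    have h2 : G.neighborFinset v = ∅ := by
      rw [← Finset.card_eq_zero, card_neighborFinset_eq_degree, h1]
    have h3 := hsub v
    rw [h1, h2] at h3
    simp only [Nat.cast_zero, zero_mul, Finset.sum_empty, add_zero] at h3
    nlinarith [mul_pos hq hv]
  obtain ⟨u, -, hu⟩ := Finset.exists_max_image Finset.univ (fun v => x v / G.degree v)
    ⟨v₀, Finset.mem_univ v₀⟩
  have hd₀ : (0 : ℝ) < G.degree v₀ := by exact_mod_cast hdeg v₀ hv₀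
  have hpos : 0 < x u / G.degree u :=
    (div_pos hv₀ hd₀).trans_le (hu v₀ (Finset.mem_univ _))
  have hxu : 0 < x u := by
    rcases (hx u).eq_or_lt with h | h
    · rw [← h, zero_div] at hpos
      exact absurd hpos (lt_irrefl _)
    · exact h
  have hdu : 0 < G.degree u := hdeg u hxu
  have hdu' : (0 : ℝ) < G.degree u := by exact_mod_cast hdu
  set r := x u / G.degree u with hr
  have hle : ∀ w, x w ≤ r * G.degree w := by
    intro w
    rcases (hx w).eq_or_lt with h | h
    · rw [← h]; positivity
    · have hdw : (0 : ℝ) < G.degree w := by exact_mod_cast hdeg w h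
      exact (div_le_iff₀ hdw).1 (hu w (Finset.mem_univ w))
  refine ⟨u, hdu, ?_⟩
  have h1 : x u = r * G.degree u := by rw [hr]; field_simp
  have h2 := hsub u
  have h3 : ∑ w ∈ G.neighborFinset u, x w ≤ r * ∑ w ∈ G.neighborFinset u, (G.degree w : ℝ) := by
    rw [Finset.mul_sum]
    exact Finset.sum_le_sum fun w _ => hle w
  rw [h1] at h2
  have h4 : r * (q * G.degree u) ≤
      r * (G.degree u * G.degree u + ∑ w ∈ G.neighborFinset u, (G.degree w : ℝ)) := by linarith
  exact le_of_mul_le_mul_left h4 hpos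

theorem sum_mul_sum_neighborFinset {V : Type*} [Fintype V] (G : SimpleGraph V)
    [DecidableRel G.Adj] (x y : V → ℝ) :
    ∑ v, y v * ∑ w ∈ G.neighborFinset v, x w = ∑ v, x v * ∑ w ∈ G.neighborFinset v, y w := by
  simp only [neighborFinset_eq_filter, Finset.sum_filter, Finset.mul_sum]
  rw [Finset.sum_comm]
  refine Finset.sum_congr rfl fun v _ => Finset.sum_congr rfl fun w _ => ?_
  by_cases h : G.Adj v w
  · rw [if_pos h, if_pos h.symm, mul_comm]
  · rw [if_neg h, if_neg (fun h' => h h'.symm)]; simp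

/-! ### The complete split graph -/

/-- The larger root `q` of `t² - (n + 2k - 2) t + 2k (k - 1)` is an eigenvalue of the signless
Laplacian of `S_{n,k}`, with the eigenvector that is `q - k` on the clique and `k` off it. -/
theorem exists_root_le_qIndex_completeSplitGraph {k n : ℕ} (hk : 1 ≤ k) (hkn : k < n) :
    ∃ q : ℝ, q ^ 2 - (n + 2 * k - 2) * q + 2 * k * (k - 1) = 0 ∧ (n : ℝ) ≤ q ∧
      q ≤ (completeSplitGraph n k).qIndex := by
  classical
  have hk' : (1 : ℝ) ≤ k := by exact_mod_cast hk
  have hkn' : (k : ℝ) < n := by exact_mod_cast hkn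
  obtain ⟨q, hnq, hroot⟩ : ∃ q : ℝ, (n : ℝ) ≤ q ∧
      q ^ 2 - (n + 2 * k - 2) * q + 2 * k * (k - 1) = 0 := by
    have hcont : Continuous fun t : ℝ => t ^ 2 - (n + 2 * k - 2) * t + 2 * k * (k - 1) := by
      fun_prop
    have := intermediate_value_Icc (show (n : ℝ) ≤ n + 2 * k by linarith) hcont.continuousOn
    obtain ⟨q, hq, hq0⟩ := this (show (0 : ℝ) ∈ _ by
      constructor
      · nlinarith
      · nlinarith)
    exact ⟨q, hq.1, hq0⟩
  refine ⟨q, hroot, hnq, ?_⟩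
  have : Nonempty (Fin k ⊕ Fin (n - k)) := ⟨Sum.inl ⟨0, hk⟩⟩
  refine le_qIndex_of_eigenvector _ (x := Sum.elim (fun _ => q - k) (fun _ => k)) ?_ ?_
  · intro v
    rw [Fintype.sum_sum_type]
    rcases v with a | a
    · have h1 : ∀ b : Fin k, (completeSplitGraph n k).Adj (Sum.inl a) (Sum.inl b) ↔ b ≠ a := by
        intro b; simp [completeSplitGraph, joinGraph, eq_comm]
      have h2 : ∀ b : Fin (n - k), (completeSplitGraph n k).Adj (Sum.inl a) (Sum.inr b) := by
        intro b; simp [completeSplitGraph, joinGraph]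
      simp only [h1, h2, if_true, Sum.elim_inl, Sum.elim_inr, Finset.sum_const,
        ← Finset.sum_filter, Finset.filter_ne', Finset.card_erase_of_mem (Finset.mem_univ a),
        Finset.card_univ, Fintype.card_fin, nsmul_eq_mul]
      rw [Nat.cast_sub hk, Nat.cast_sub hkn.le]
      push_cast
      linarith
    · have h1 : ∀ b : Fin k, (completeSplitGraph n k).Adj (Sum.inr a) (Sum.inl b) := by
        intro b; simp [completeSplitGraph, joinGraph]
      have h2 : ∀ b : Fin (n - k), ¬ (completeSplitGraph n k).Adj (Sum.inr a) (Sum.inr b) := by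
        intro b; simp [completeSplitGraph, joinGraph]
      simp only [h1, h2, if_true, if_false, Sum.elim_inl, Sum.elim_inr, Finset.sum_const,
        Finset.card_univ, Fintype.card_fin, nsmul_eq_mul]
      ring
  · intro h0
    have h1 := congrFun h0 (Sum.inl ⟨0, hk⟩)
    simp only [Sum.elim_inl, Pi.zero_apply] at h1
    linarith

/-- A graph is `S_{n,k}` as soon as `k` of its vertices are dominating and the others are
independent. -/
theorem nonempty_iso_completeSplitGraph {V : Type*} [Fintype V] [DecidableEq V]
    {G : SimpleGraph V} {k n : ℕ} (hV : Fintype.card V = n) {L : Finset V} (hL : L.card = k)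
    (hdom : ∀ v ∈ L, ∀ w, w ≠ v → G.Adj v w)
    (hind : ∀ v, v ∉ L → ∀ w, w ∉ L → ¬ G.Adj v w) :
    Nonempty (G ≃g completeSplitGraph n k) := by
  have e₁ : {v // v ∈ L} ≃ Fin k := Fintype.equivFinOfCardEq (by simpa using hL)
  have e₂ : {v // v ∉ L} ≃ Fin (n - k) := Fintype.equivFinOfCardEq (by
    rw [Fintype.card_subtype_compl, hV]; simp [hL])
  let e : {v // v ∈ L} ⊕ {v // v ∉ L} ≃ V := Equiv.sumCompl (· ∈ L)
  refine ⟨RelIso.mk (e.symm.trans (Equiv.sumCongr e₁ e₂)) ?_⟩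
  intro a b
  obtain ⟨a, rfl⟩ := e.surjective a
  obtain ⟨b, rfl⟩ := e.surjective b
  rw [Equiv.trans_apply, Equiv.trans_apply, Equiv.symm_apply_apply, Equiv.symm_apply_apply]
  rcases a with a | a <;> rcases b with b | b
  · change (completeSplitGraph n k).Adj (Sum.inl (e₁ a)) (Sum.inl (e₁ b)) ↔ G.Adj a.1 b.1
    have h : (completeSplitGraph n k).Adj (Sum.inl (e₁ a)) (Sum.inl (e₁ b)) ↔ a ≠ b := by
      simp [completeSplitGraph, joinGraph]
    rw [h]
    exact ⟨fun h => hdom _ a.2 _ (fun hab => h (Subtype.ext hab.symm)),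
      fun h hab => h.ne (congrArg _ hab)⟩
  · change (completeSplitGraph n k).Adj (Sum.inl (e₁ a)) (Sum.inr (e₂ b)) ↔ G.Adj a.1 b.1
    have h : (completeSplitGraph n k).Adj (Sum.inl (e₁ a)) (Sum.inr (e₂ b)) := by
      simp [completeSplitGraph, joinGraph]
    exact iff_of_true h (hdom _ a.2 _ (fun hab => b.2 (hab ▸ a.2)))
  · change (completeSplitGraph n k).Adj (Sum.inr (e₂ a)) (Sum.inl (e₁ b)) ↔ G.Adj a.1 b.1
    have h : (completeSplitGraph n k).Adj (Sum.inr (e₂ a)) (Sum.inl (e₁ b)) := by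
      simp [completeSplitGraph, joinGraph]
    exact iff_of_true h (hdom _ b.2 _ (fun hab : a.1 = b.1 => a.2 (by rw [hab]; exact b.2))).symm
  · change (completeSplitGraph n k).Adj (Sum.inr (e₂ a)) (Sum.inr (e₂ b)) ↔ G.Adj a.1 b.1
    have h : ¬ (completeSplitGraph n k).Adj (Sum.inr (e₂ a)) (Sum.inr (e₂ b)) := by
      simp [completeSplitGraph, joinGraph]
    exact iff_of_false h (hind _ a.2 _ b.2)

/-- Strict monotonicity of the `Q`-index below `S_{n,k}`: if every edge of `G` meets a `k`-set `L`
on which a subinvariant vector is positive, and its factor is at least the root `q₀` belonging to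
`S_{n,k}`, then every vertex of `L` is dominating. The vector is paired with the eigenvector of
`S_{n,k}`. -/
theorem dominating_of_subinvariant {V : Type*} [Fintype V] [DecidableEq V] (G : SimpleGraph V)
    [DecidableRel G.Adj] {k n : ℕ} (hk : 1 ≤ k) (hkn : k < n) (hV : Fintype.card V = n)
    {q₀ q : ℝ} (hroot : q₀ ^ 2 - (n + 2 * k - 2) * q₀ + 2 * k * (k - 1) = 0) (hnq : (n : ℝ) ≤ q₀)
    (hq : q₀ ≤ q) {x : V → ℝ} (hx : ∀ v, 0 ≤ x v)
    (hsub : ∀ v, q * x v ≤ G.degree v * x v + ∑ w ∈ G.neighborFinset v, x w)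
    {L : Finset V} (hL : L.card = k) (hxL : ∀ v ∈ L, 0 < x v)
    (hind : ∀ v, v ∉ L → ∀ w, w ∉ L → ¬ G.Adj v w) :
    ∀ v ∈ L, ∀ w, w ≠ v → G.Adj v w := by
  have hk' : (1 : ℝ) ≤ k := by exact_mod_cast hk
  have hkn' : (k : ℝ) < n := by exact_mod_cast hkn
  set y : V → ℝ := fun v => if v ∈ L then q₀ - k else k with hy
  have hyL : ∀ v ∈ L, y v = q₀ - k := fun v hv => if_pos hv
  have hyL' : ∀ v, v ∉ L → y v = k := fun v hv => if_neg hv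
  have hypos : ∀ v, 0 < y v := by
    intro v
    simp only [hy]
    split_ifs <;> linarith
  have hLsum : ∀ c : ℝ, ∑ w ∈ L, (c + y w) = k * (c + (q₀ - k)) := by
    intro c
    rw [Finset.sum_congr rfl (fun w hw => by rw [hyL w hw]), Finset.sum_const, hL,
      nsmul_eq_mul]
  have hLsum' : ∀ c : ℝ, ∑ w ∈ Lᶜ, (c + y w) = (n - k) * (c + k) := by
    intro c
    rw [Finset.sum_congr rfl (fun w hw => by
      rw [hyL' w (Finset.mem_compl.1 hw)]), Finset.sum_const, Finset.card_compl, hL,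
      hV, nsmul_eq_mul, Nat.cast_sub hkn.le]
  have htot : ∀ v ∈ L, ∑ w, (if w ≠ v then y v + y w else 0) = q₀ * y v := by
    intro v hv
    have h1 := Finset.sum_erase_eq_sub (f := fun w => y v + y w) (Finset.mem_univ v)
    rw [← Finset.sum_filter, Finset.filter_ne', h1, ← Finset.sum_add_sum_compl L, hLsum, hLsum']
    rw [hyL v hv]
    linarith
  have hQ : ∀ v, G.degree v * y v + ∑ w ∈ G.neighborFinset v, y w ≤ q₀ * y v := by
    intro v
    rw [degree_mul_add_sum_neighborFinset]
    by_cases hv : v ∈ L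
    · rw [← htot v hv]
      refine Finset.sum_le_sum fun w _ => ?_
      have := hypos v
      have := hypos w
      by_cases h : G.Adj v w
      · rw [if_pos h, if_pos h.ne']
      · rw [if_neg h]
        split_ifs <;> linarith
    · have h1 : ∑ w, (if G.Adj v w then y v + y w else 0) ≤
          ∑ w, (if w ∈ L then y v + y w else 0) := by
        refine Finset.sum_le_sum fun w _ => ?_
        have := hypos v
        have := hypos w
        by_cases h : G.Adj v w
        · have hw : w ∈ L := by
            by_contra hw
            exact hind v hv w hw h
          rw [if_pos h, if_pos hw]
        · rw [if_neg h]
          split_ifs <;> linarith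
      refine h1.trans ?_
      rw [← Finset.sum_filter, Finset.filter_univ_mem, hLsum]
      rw [hyL' v hv]
      linarith
  have hpair : ∑ v, x v * (q₀ * y v) ≤
      ∑ v, x v * (G.degree v * y v + ∑ w ∈ G.neighborFinset v, y w) := by
    have h1 : ∑ v, x v * (q₀ * y v) ≤
        ∑ v, y v * (G.degree v * x v + ∑ w ∈ G.neighborFinset v, x w) := by
      refine Finset.sum_le_sum fun v _ => ?_
      have h2 := mul_le_mul_of_nonneg_left (hsub v) (hypos v).le
      have h3 := mul_le_mul_of_nonneg_right hq (mul_nonneg (hx v) (hypos v).le)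
      linarith
    refine h1.trans_eq ?_
    simp only [mul_add, Finset.sum_add_distrib]
    rw [sum_mul_sum_neighborFinset]
    congr 1
    exact Finset.sum_congr rfl fun v _ => by ring
  have heq := (Finset.sum_eq_sum_iff_of_le (fun v _ =>
    mul_le_mul_of_nonneg_left (hQ v) (hx v))).1
    (le_antisymm (Finset.sum_le_sum fun v _ => mul_le_mul_of_nonneg_left (hQ v) (hx v)) hpair)
  intro v hv w hwv
  by_contra hadj
  have h1 := mul_left_cancel₀ (hxL v hv).ne' (heq v (Finset.mem_univ v))
  rw [degree_mul_add_sum_neighborFinset, ← htot v hv] at h1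
  refine h1.not_lt (Finset.sum_lt_sum (fun z _ => ?_) ⟨w, Finset.mem_univ w, ?_⟩)
  · have := hypos v
    have := hypos z
    by_cases h : G.Adj v z
    · rw [if_pos h, if_pos h.ne']
    · rw [if_neg h]
      split_ifs <;> linarith
  · rw [if_neg hadj, if_pos hwv]
    exact add_pos (hypos v) (hypos w)

/-! ### Around the Merris vertex -/

/-- For `w` adjacent to `u`, the degree of `w` splits into `1` (for `u`), the degree into the
neighbourhood of `u` and the degree into the non-neighbours of `u`. -/
theorem degree_eq_of_adj {V : Type*} [Fintype V] [DecidableEq V] (G : SimpleGraph V)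
    [DecidableRel G.Adj] {u a : V} (h : G.Adj u a) :
    G.degree a = 1 + {w ∈ G.neighborFinset u | G.Adj a w}.card +
      {w ∈ (insert u (G.neighborFinset u))ᶜ | G.Adj a w}.card := by
  have h1 : G.neighborFinset a = insert u {w ∈ G.neighborFinset u | G.Adj a w} ∪
      {w ∈ (insert u (G.neighborFinset u))ᶜ | G.Adj a w} := by
    ext w
    simp only [mem_neighborFinset, Finset.mem_union, Finset.mem_insert, Finset.mem_filter,
      Finset.mem_compl]
    by_cases hw : w = u
    · subst hw; simp [h.symm]
    · simp only [hw, false_or]; tauto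
  rw [← card_neighborFinset_eq_degree, h1, Finset.card_union_of_disjoint,
    Finset.card_insert_of_notMem (by simp), add_comm 1]
  rw [Finset.disjoint_left]
  intro w hw hw'
  simp only [mem_neighborFinset, Finset.mem_insert, Finset.mem_filter, Finset.mem_compl] at hw hw'
  tauto

/-- In a graph without `C_{2k+1}`, no set of neighbours of a vertex induces a path on `2k`
vertices, so the Erdős–Gallai bound applies to it. -/
theorem sum_degree_within_neighbors_le {V : Type*} [Fintype V] [DecidableEq V]
    (G : SimpleGraph V) [DecidableRel G.Adj] {k : ℕ} (hk : 1 ≤ k)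
    (hG : (cycleGraph (2 * k + 1)).Free G) {u : V} {X : Finset V} (hX : X ⊆ G.neighborFinset u) :
    ∑ a ∈ X, {w ∈ X | G.Adj a w}.card ≤ (2 * k - 2) * X.card := by
  refine sum_degree_within_le_of_no_path G hk X fun l h1 h2 h3 h4 => hG ?_
  have hu : ∀ x ∈ l, G.Adj u x := fun x hx => (G.mem_neighborFinset u x).1 (hX (h3 x hx))
  have hlen : (u :: l).length = 2 * k + 1 := by rw [List.length_cons, h4]
  rw [← hlen]
  refine cycleGraph_isContained_of_isChain (List.nodup_cons.2 ⟨fun h => (hu u h).ne rfl, h1⟩)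
    (h2.cons fun y hy => hu y (List.mem_of_mem_head? hy)) ?_
  intro a ha b hb
  have hne : l ≠ [] := by rintro rfl; simp at h4; omega
  rw [List.head?_cons, Option.mem_def, Option.some.injEq] at hb
  subst hb
  have ha' : a ∈ l := by
    obtain ⟨x, l', rfl⟩ := List.exists_cons_of_ne_nil hne
    rw [List.getLast?_cons_cons] at ha
    exact List.mem_of_getLast? ha
  exact (hu a ha').symm

/-- If the Merris vertex `u` has at least `k - 1` non-neighbours, an edge among the neighbours of
`u` extends to a cycle `C_{2k+1}` that alternates between the neighbours of `u` and `k` hubs, one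
of them `u` and the others non-neighbours of `u`. -/
theorem cycleGraph_isContained_of_many_nonneighbors {V : Type*} [Fintype V] [DecidableEq V]
    (G : SimpleGraph V) [DecidableRel G.Adj] {k : ℕ} (hk : 3 ≤ k) {u : V} {e : ℝ}
    (he : 55 * e ≤ 1) (hd : 0 < G.degree u)
    (hα : (2 * k - 2 - e) * G.degree u ≤
      ∑ a ∈ G.neighborFinset u, ({w ∈ G.neighborFinset u | G.Adj a w}.card : ℝ))
    (hβ : ∑ a ∈ G.neighborFinset u, (((insert u (G.neighborFinset u))ᶜ.card : ℝ) -
      {w ∈ (insert u (G.neighborFinset u))ᶜ | G.Adj a w}.card) ≤ e * G.degree u)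
    (hb : k - 1 ≤ (insert u (G.neighborFinset u))ᶜ.card) :
    cycleGraph (2 * k + 1) ⊑ G := by
  by_contra hG
  set A := G.neighborFinset u with hA
  set B := (insert u A)ᶜ with hB
  set d := G.degree u with hd_def
  have hAcard : A.card = d := card_neighborFinset_eq_degree G u
  have hk' : (3 : ℝ) ≤ k := by exact_mod_cast hk
  have hd' : (0 : ℝ) < d := by exact_mod_cast hd
  have hb' : (2 : ℝ) ≤ B.card := by
    have : 2 ≤ B.card := by omega
    exact_mod_cast this
  have hterm : ∀ a, (0 : ℝ) ≤ (B.card : ℝ) - {w ∈ B | G.Adj a w}.card := fun a => by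
    rw [sub_nonneg]
    exact_mod_cast Finset.card_filter_le _ _
  have hdk : 2 * k - 1 ≤ d := by
    have h1 : ∑ a ∈ A, ({w ∈ A | G.Adj a w}.card : ℝ) ≤ d * (d - 1) := by
      have h2 : ∀ a ∈ A, ({w ∈ A | G.Adj a w}.card : ℝ) ≤ d - 1 := by
        intro a ha
        have h3 : {w ∈ A | G.Adj a w} ⊆ A.erase a := fun w hw => by
          rw [Finset.mem_filter] at hw
          exact Finset.mem_erase.2 ⟨hw.2.ne', hw.1⟩
        have h4 := Finset.card_le_card h3
        have h5 := Finset.card_erase_add_one ha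
        rw [le_sub_iff_add_le]
        exact_mod_cast (by omega : {w ∈ A | G.Adj a w}.card + 1 ≤ d)
      have := Finset.sum_le_card_nsmul _ _ _ h2
      rwa [hAcard, nsmul_eq_mul] at this
    have h3 : (2 * k - 2 - e) * d ≤ (d - 1) * d := by linarith
    have h4 := le_of_mul_le_mul_right h3 hd'
    by_contra! hlt
    have h5 : d + 2 ≤ 2 * k := by omega
    have h6 : (d : ℝ) + 2 ≤ 2 * k := by exact_mod_cast h5
    linarith
  have hdk' : (2 * k - 1 : ℝ) ≤ d := by
    have : 2 * k ≤ d + 1 := by omega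
    have : (2 * k : ℝ) ≤ d + 1 := by exact_mod_cast this
    linarith
  -- an edge of the neighbourhood with an end that has a neighbour outside
  obtain ⟨a₁, ha₁, a₂, ha₂, b, hbB, h12, h2b⟩ :
      ∃ a₁ ∈ A, ∃ a₂ ∈ A, ∃ b ∈ B, G.Adj a₁ a₂ ∧ G.Adj a₂ b := by
    by_contra! hno
    set X := {a ∈ A | ∀ b ∈ B, ¬ G.Adj a b} with hX
    have hXA : X ⊆ A := Finset.filter_subset _ _
    have hmemX : ∀ a ∈ A, ∀ w ∈ A, G.Adj a w → w ∈ X := fun a ha w hw haw =>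
      Finset.mem_filter.2 ⟨hw, fun b hb => hno a ha w hw b hb haw⟩
    have h1 : ∑ a ∈ A, {w ∈ A | G.Adj a w}.card = ∑ a ∈ X, {w ∈ X | G.Adj a w}.card := by
      rw [← Finset.sum_subset hXA]
      · refine Finset.sum_congr rfl fun a ha => congrArg _ ?_
        ext w
        simp only [Finset.mem_filter]
        exact ⟨fun h => ⟨hmemX a (hXA ha) w h.1 h.2, h.2⟩, fun h => ⟨hXA h.1, h.2⟩⟩
      · intro a ha haX
        rw [Finset.card_eq_zero, Finset.filter_eq_empty_iff]
        exact fun w hw haw => haX (hmemX w hw a ha haw.symm)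
    have h2 : (∑ a ∈ A, {w ∈ A | G.Adj a w}.card) ≤ (2 * k - 2) * X.card :=
      h1 ▸ sum_degree_within_neighbors_le G (by omega) hG hXA
    have h3 : (∑ a ∈ A, ({w ∈ A | G.Adj a w}.card : ℝ)) ≤ (2 * k - 2) * X.card := by
      have : ((2 * k - 2 : ℕ) : ℝ) = 2 * k - 2 := by
        rw [Nat.cast_sub (by omega)]; push_cast; ring
      rw [← this]
      exact_mod_cast h2
    have h4 : (X.card : ℝ) * B.card ≤ e * d := by
      refine le_trans ?_ hβ
      refine le_trans ?_ (Finset.sum_le_sum_of_subset_of_nonneg hXA fun a _ _ => hterm a)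
      rw [← nsmul_eq_mul]
      refine Finset.card_nsmul_le_sum _ _ _ fun a ha => ?_
      rw [Finset.filter_eq_empty_iff.2 fun b hb => (Finset.mem_filter.1 ha).2 b hb]
      simp
    have h5 : (X.card : ℝ) * 2 ≤ e * d :=
      (mul_le_mul_of_nonneg_left hb' (Nat.cast_nonneg _)).trans h4
    have h6 : (2 * k - 2 - e) * d * 2 ≤ (2 * k - 2) * e * d := by
      have := mul_le_mul_of_nonneg_left h5 (show (0 : ℝ) ≤ 2 * k - 2 by linarith)
      linarith
    have h7 : (2 * k - 2 - e) * 2 ≤ (2 * k - 2) * e := le_of_mul_le_mul_right (by linarith) hd'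
    nlinarith
  -- the neighbours of `u` adjacent to everything outside
  set A' := {a ∈ A | ∀ w ∈ B, G.Adj a w} with hA'
  have hA'card : k + 1 ≤ A'.card := by
    have h1 : ((A \ A').card : ℝ) ≤ e * d := by
      refine le_trans ?_ hβ
      refine le_trans ?_ (Finset.sum_le_sum_of_subset_of_nonneg (Finset.sdiff_subset (t := A'))
        fun a _ _ => hterm a)
      have : ((A \ A').card : ℝ) = (A \ A').card • (1 : ℝ) := by simp
      rw [this]
      refine Finset.card_nsmul_le_sum _ _ _ fun a ha => ?_
      rw [Finset.mem_sdiff, hA', Finset.mem_filter, not_and] at ha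
      have h2 := ha.2 ha.1
      push Not at h2
      obtain ⟨w, hwB, hw⟩ := h2
      have h3 : {w ∈ B | G.Adj a w}.card < B.card :=
        Finset.card_lt_card (Finset.filter_ssubset.2 ⟨w, hwB, hw⟩)
      rw [le_sub_iff_add_le, add_comm]
      exact_mod_cast h3
    have h2 : (A \ A').card + A'.card = d := by
      rw [Finset.card_sdiff_add_card_eq_card (Finset.filter_subset _ _), hAcard]
    have h3 : ((A \ A').card : ℝ) + A'.card = d := by exact_mod_cast h2
    by_contra! hlt
    have h4 : (A'.card : ℝ) ≤ k := by exact_mod_cast (by omega : A'.card ≤ k)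
    nlinarith
  -- the hubs are `b`, further `k - 2` vertices outside, and `u`
  obtain ⟨B', hB'B, hB'card⟩ : ∃ B' ⊆ B.erase b, B'.card = k - 2 :=
    Finset.exists_subset_card_eq (by rw [Finset.card_erase_of_mem hbB]; omega)
  have huA : u ∉ A := by simp [hA]
  have hBu : ∀ w ∈ B, w ≠ u ∧ w ∉ A := by
    intro w hw
    rw [hB, Finset.mem_compl, Finset.mem_insert, not_or] at hw
    exact hw
  have hhub : ∀ a ∈ b :: (B'.toList ++ [u]), a = u ∨ a ∈ B := by
    intro a ha
    simp only [List.mem_cons, List.mem_append, Finset.mem_toList, List.not_mem_nil,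
      or_false] at ha
    rcases ha with rfl | ha | rfl
    · exact Or.inr hbB
    · exact Or.inr (Finset.mem_of_mem_erase (hB'B ha))
    · exact Or.inl rfl
  have hhubA : ∀ a ∈ b :: (B'.toList ++ [u]), a ∉ A := by
    intro a ha
    rcases hhub a ha with rfl | h
    · exact huA
    · exact (hBu a h).2
  have hhubadj : ∀ a ∈ b :: (B'.toList ++ [u]), ∀ w ∈ A', G.Adj a w := by
    intro a ha w hw
    rw [hA', Finset.mem_filter] at hw
    rcases hhub a ha with rfl | h
    · exact (G.mem_neighborFinset _ _).1 hw.1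
    · exact (hw.2 a h).symm
  have hlen : (B'.toList ++ [u]).length = k - 1 := by
    rw [List.length_append, Finset.length_toList, hB'card, List.length_singleton]; omega
  have hk2 : 2 * ((B'.toList ++ [u]).length + 1) + 1 = 2 * k + 1 := by rw [hlen]; omega
  have hA'A : A' ⊆ A := Finset.filter_subset _ _
  refine hG (hk2 ▸ cycleGraph_isContained_of_hubs G (h := b) (c := u) (r := a₂) (r' := a₁)
    (P := (A'.erase a₁).erase a₂) ?_ ?_ ?_ ?_ ?_ ?_ ?_ ?_ h2b ?_ h12.symm)
  · rw [List.nodup_cons, List.nodup_append]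
    refine ⟨?_, B'.nodup_toList, by simp, ?_⟩
    · simp only [List.mem_append, Finset.mem_toList, List.mem_singleton, not_or]
      exact ⟨fun h => (Finset.mem_erase.1 (hB'B h)).1 rfl, (hBu b hbB).1⟩
    · intro x hx y hy
      rw [List.mem_singleton] at hy
      subst hy
      exact (hBu x (Finset.mem_of_mem_erase (hB'B (Finset.mem_toList.1 hx)))).1
  · exact fun a ha haP => hhubA a ha
      (hA'A (Finset.mem_of_mem_erase (Finset.mem_of_mem_erase haP)))
  · intro x hx y hy _
    have h1 : {w ∈ (A'.erase a₁).erase a₂ | G.Adj x w ∧ G.Adj y w} = (A'.erase a₁).erase a₂ := by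
      refine Finset.filter_true_of_mem fun w hw => ?_
      have hw' : w ∈ A' := Finset.mem_of_mem_erase (Finset.mem_of_mem_erase hw)
      exact ⟨hhubadj x hx w hw', hhubadj y hy w hw'⟩
    rw [h1, hlen]
    have h2 := Finset.pred_card_le_card_erase (s := A') (a := a₁)
    have h3 := Finset.pred_card_le_card_erase (s := A'.erase a₁) (a := a₂)
    omega
  · rw [← List.cons_append, List.getLast?_append]
    simp
  · exact fun h => hhubA a₂ h ha₂
  · exact fun h => hhubA a₁ h ha₁
  · simp
  · simp
  · exact ((G.mem_neighborFinset _ _).1 ha₁).symm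

/-! ### Cycles through vertices of large degree -/

/-- Two vertices of degree more than `n / 2 + k` have more than `2k` common neighbours. -/
theorem two_mul_lt_card_common_add {V : Type*} [Fintype V] [DecidableEq V] (G : SimpleGraph V)
    [DecidableRel G.Adj] {k : ℕ} {a b : V} (ha : Fintype.card V + 2 * k + 1 ≤ 2 * G.degree a)
    (hb : Fintype.card V + 2 * k + 1 ≤ 2 * G.degree b) (F : Finset V) :
    2 * k < {w ∈ Fᶜ | G.Adj a w ∧ G.Adj b w}.card + F.card := by
  have h1 := Finset.card_union_add_card_inter (G.neighborFinset a) (G.neighborFinset b)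
  have h2 := Finset.card_le_univ (G.neighborFinset a ∪ G.neighborFinset b)
  rw [card_neighborFinset_eq_degree, card_neighborFinset_eq_degree] at h1
  have h3 : G.neighborFinset a ∩ G.neighborFinset b ⊆
      {w ∈ Fᶜ | G.Adj a w ∧ G.Adj b w} ∪ F := by
    intro w hw
    simp only [Finset.mem_inter, mem_neighborFinset, Finset.mem_union, Finset.mem_filter,
      Finset.mem_compl] at hw ⊢
    tauto
  have h4 := (Finset.card_le_card h3).trans (Finset.card_union_le _ _)
  omega

/-- More than `k` vertices of large degree, two of them adjacent, lie on a `C_{2k+1}`: alternate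
between `k + 1` of them and their common neighbours, from one end of the edge to the other. -/
theorem cycleGraph_isContained_of_large_degree {V : Type*} [Fintype V] [DecidableEq V]
    (G : SimpleGraph V) [DecidableRel G.Adj] {k : ℕ} (hk : 1 ≤ k) {L : Finset V}
    (hL : ∀ v ∈ L, Fintype.card V + 2 * k + 1 ≤ 2 * G.degree v) (hcard : k < L.card) {c c' : V}
    (hc : c ∈ L) (hc' : c' ∈ L) (hadj : G.Adj c c') : cycleGraph (2 * k + 1) ⊑ G := by
  obtain ⟨H, hcH, hHL, hH⟩ := Finset.exists_subsuperset_card_eq (s := {c, c'}) (t := L)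
    (n := k + 1) (by simp [Finset.insert_subset_iff, hc, hc'])
    (by rw [Finset.card_pair hadj.ne]; omega) hcard
  have hcH' : c ∈ H := hcH (by simp)
  have hcH'' : c' ∈ H := hcH (by simp)
  have hmem : ∀ a ∈ c :: (((H.erase c).erase c').toList ++ [c']), a ∈ H := by
    intro a ha
    simp only [List.mem_cons, List.mem_append, Finset.mem_toList, Finset.mem_erase,
      List.not_mem_nil, or_false] at ha
    rcases ha with rfl | ha | rfl
    · exact hcH'
    · exact ha.2.2
    · exact hcH''
  have hlen : (((H.erase c).erase c').toList ++ [c']).length = k := by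
    rw [List.length_append, Finset.length_toList, List.length_singleton,
      Finset.card_erase_of_mem (Finset.mem_erase.2 ⟨hadj.ne', hcH''⟩),
      Finset.card_erase_of_mem hcH', hH]
    omega
  obtain ⟨l, l1, l2, l3, l4, l5, -⟩ := exists_alternating_path G
    (((H.erase c).erase c').toList ++ [c']) c Hᶜ
    (by
      rw [List.nodup_cons, List.nodup_append]
      refine ⟨?_, Finset.nodup_toList _, by simp, ?_⟩
      · simp [hadj.ne]
      · intro x hx y hy
        rw [List.mem_singleton] at hy
        subst hy
        exact (Finset.mem_erase.1 (Finset.mem_toList.1 hx)).1)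
    (fun a ha haP => Finset.mem_compl.1 haP (hmem a ha))
    (fun a ha b hb _ => by
      have := two_mul_lt_card_common_add G (hL a (hHL (hmem a ha))) (hL b (hHL (hmem b hb))) H
      omega)
  rw [hlen] at l3
  rw [← l3]
  refine cycleGraph_isContained_of_isChain l1 l2 ?_
  intro x hx y hy
  rw [l5, ← List.cons_append, List.getLast?_append] at hx
  rw [l4] at hy
  simp only [List.getLast?_singleton, Option.mem_def, Option.some_or, Option.some.injEq] at hx hy
  subst hx hy
  exact hadj.symm

/-- An edge outside of `k` vertices of large degree, whose ends are adjacent to different ones of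
them, lies on a `C_{2k+1}` with these `k` vertices as hubs. -/
theorem cycleGraph_isContained_of_edge_outside {V : Type*} [Fintype V] [DecidableEq V]
    (G : SimpleGraph V) [DecidableRel G.Adj] {k : ℕ} {L : Finset V}
    (hL : ∀ v ∈ L, Fintype.card V + 2 * k + 1 ≤ 2 * G.degree v) (hcard : L.card = k) {c u r r' : V}
    (hc : c ∈ L) (hu : u ∈ L) (hcu : c ≠ u) (hr : r ∉ L) (hr' : r' ∉ L) (hrc : G.Adj r c)
    (hru : G.Adj r' u) (hrr : G.Adj r r') : cycleGraph (2 * k + 1) ⊑ G := by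
  have hmem : ∀ a ∈ c :: (((L.erase c).erase u).toList ++ [u]), a ∈ L := by
    intro a ha
    simp only [List.mem_cons, List.mem_append, Finset.mem_toList, Finset.mem_erase,
      List.not_mem_nil, or_false] at ha
    rcases ha with rfl | ha | rfl
    · exact hc
    · exact ha.2.2
    · exact hu
  have hk2 : 2 ≤ L.card := by
    rw [← Finset.card_pair hcu]
    exact Finset.card_le_card (by simp [Finset.insert_subset_iff, hc, hu])
  have hlen : (((L.erase c).erase u).toList ++ [u]).length + 1 = k := by
    rw [List.length_append, Finset.length_toList, List.length_singleton,
      Finset.card_erase_of_mem (Finset.mem_erase.2 ⟨hcu.symm, hu⟩),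
      Finset.card_erase_of_mem hc]
    omega
  have := cycleGraph_isContained_of_hubs G (h := c) (t := ((L.erase c).erase u).toList ++ [u])
    (c := u) (r := r) (r' := r') (P := (insert r (insert r' L))ᶜ)
    (by
      rw [List.nodup_cons, List.nodup_append]
      refine ⟨?_, Finset.nodup_toList _, by simp, ?_⟩
      · simp [hcu]
      · intro x hx y hy
        rw [List.mem_singleton] at hy
        subst hy
        exact (Finset.mem_erase.1 (Finset.mem_toList.1 hx)).1)
    (fun a ha haP => by
      have := hmem a ha
      simp [this] at haP)
    (fun a ha b hb _ => by
      have h1 := two_mul_lt_card_common_add G (hL a (hmem a ha)) (hL b (hmem b hb))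
        (insert r (insert r' L))
      have h2 := Finset.card_insert_le r (insert r' L)
      have h3 := Finset.card_insert_le r' L
      omega)
    (by rw [← List.cons_append, List.getLast?_append]; simp)
    (fun h => hr (hmem r h)) (fun h => hr' (hmem r' h)) (by simp) (by simp) hrc hru hrr
  rwa [hlen] at this

/-! ### Weight of the vertices of large degree -/

/-- The bound `n x v ≤ 2 S` off `L` makes the vertices off `L` contribute little to
`q S ≤ 2 ∑ d(v) x v`, so that about half of the total weight `S` lies on `L`. -/
theorem weight_le_of_subinvariant {V : Type*} [Fintype V] [DecidableEq V] (G : SimpleGraph V)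
    [DecidableRel G.Adj] {k n : ℕ} (hk : 3 ≤ k) (hn : 110 * k ^ 2 ≤ n) (hV : Fintype.card V = n)
    {q e : ℝ} (he : 55 * e ≤ 1) (hq : n + 2 * k - 2 - e ≤ q)
    {x : V → ℝ} (hx : ∀ v, 0 ≤ x v)
    (hsub : ∀ v, q * x v ≤ G.degree v * x v + ∑ w ∈ G.neighborFinset v, x w)
    {L : Finset V} (hL : ∀ v, v ∉ L → 2 * G.degree v ≤ n + 2 * k)
    (hdeg : ∑ v ∈ Lᶜ, G.degree v ≤ (3 * k - 3) * n) :
    (∑ v, x v) * (n - 10 * k) ≤ 2 * n * ∑ v ∈ L, x v := by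
  have hk' : (3 : ℝ) ≤ k := by exact_mod_cast hk
  have hn' : (110 * k ^ 2 : ℝ) ≤ n := by exact_mod_cast hn
  have hnpos : (0 : ℝ) < n := by nlinarith
  set S := ∑ v, x v with hS
  have hS0 : 0 ≤ S := Finset.sum_nonneg fun v _ => hx v
  have hloc : ∀ v, (q + 1 - G.degree v) * x v ≤ S := by
    intro v
    have h1 : ∑ w ∈ insert v (G.neighborFinset v), x w ≤ S :=
      Finset.sum_le_sum_of_subset_of_nonneg (Finset.subset_univ _) fun w _ _ => hx w
    rw [Finset.sum_insert (by simp)] at h1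
    have := hsub v
    linarith
  have hsmall : ∀ v ∈ Lᶜ, n * x v ≤ 2 * S := by
    intro v hv
    have h1 : (2 * G.degree v : ℝ) ≤ n + 2 * k := by
      exact_mod_cast hL v (Finset.mem_compl.1 hv)
    have h2 := hloc v
    have h3 : (n : ℝ) ≤ 2 * (q + 1 - G.degree v) := by linarith
    have := mul_le_mul_of_nonneg_right h3 (hx v)
    linarith
  have hoff : ∑ v ∈ Lᶜ, (G.degree v : ℝ) * x v ≤ 6 * (k - 1) * S := by
    have h1 : ∑ v ∈ Lᶜ, (G.degree v : ℝ) * (n * x v) ≤ ∑ v ∈ Lᶜ, (G.degree v : ℝ) * (2 * S) :=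
      Finset.sum_le_sum fun v hv => mul_le_mul_of_nonneg_left (hsmall v hv) (Nat.cast_nonneg _)
    rw [← Finset.sum_mul] at h1
    have h2 : ∑ v ∈ Lᶜ, (G.degree v : ℝ) ≤ (3 * k - 3) * n := by
      have : ((3 * k - 3 : ℕ) : ℝ) = 3 * k - 3 := by
        rw [Nat.cast_sub (by omega)]; push_cast; ring
      rw [← this]
      exact_mod_cast hdeg
    have h3 := mul_le_mul_of_nonneg_right h2 (show 0 ≤ 2 * S by linarith)
    have h4 : ∑ v ∈ Lᶜ, (G.degree v : ℝ) * (n * x v) = n * ∑ v ∈ Lᶜ, (G.degree v : ℝ) * x v := by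
      rw [Finset.mul_sum]
      exact Finset.sum_congr rfl fun v _ => by ring
    rw [h4] at h1
    refine le_of_mul_le_mul_left (h1.trans (h3.trans_eq ?_)) hnpos
    ring
  have hon : ∑ v ∈ L, (G.degree v : ℝ) * x v ≤ n * ∑ v ∈ L, x v := by
    rw [Finset.mul_sum]
    refine Finset.sum_le_sum fun v _ => mul_le_mul_of_nonneg_right ?_ (hx v)
    have := G.degree_lt_card_verts v
    rw [hV] at this
    exact_mod_cast this.le
  have htot : q * S ≤ 2 * ∑ v, (G.degree v : ℝ) * x v := by
    have h1 : q * S ≤ ∑ v, (G.degree v * x v + ∑ w ∈ G.neighborFinset v, x w) := by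
      rw [hS, Finset.mul_sum]
      exact Finset.sum_le_sum fun v _ => hsub v
    have h2 := sum_mul_sum_neighborFinset G x (fun _ => 1)
    simp only [one_mul, Finset.sum_const, card_neighborFinset_eq_degree, nsmul_eq_mul,
      mul_one] at h2
    rw [Finset.sum_add_distrib, h2] at h1
    have h3 : ∑ v, x v * (G.degree v : ℝ) = ∑ v, (G.degree v : ℝ) * x v :=
      Finset.sum_congr rfl fun v _ => mul_comm _ _
    linarith
  rw [← Finset.sum_add_sum_compl L] at htot
  have h5 : (n : ℝ) - 10 * k ≤ q - 12 * (k - 1) := by linarith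
  have h6 := mul_le_mul_of_nonneg_left h5 hS0
  linarith

/-- If few vertices are non-adjacent to the Merris vertex, then all edges meet a set of `k`
vertices of positive weight. -/
theorem exists_cover_of_few_nonneighbors {V : Type*} [Fintype V] [DecidableEq V]
    (G : SimpleGraph V) [DecidableRel G.Adj] {k n : ℕ} (hk : 3 ≤ k) (hn : 110 * k ^ 2 ≤ n)
    (hV : Fintype.card V = n) (hG : (cycleGraph (2 * k + 1)).Free G)
    {q e : ℝ} (he0 : 0 ≤ e) (he : 55 * e ≤ 1) (hen : n * e ≤ 2 * k * (k - 1))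
    (hq : n + 2 * k - 2 - e ≤ q)
    {x : V → ℝ} (hx : ∀ v, 0 ≤ x v) (hx1 : ∀ v, x v ≤ 1) (hxmax : ∃ v, x v = 1)
    (hsub : ∀ v, q * x v ≤ G.degree v * x v + ∑ w ∈ G.neighborFinset v, x w) {u : V}
    (hβ : ∑ a ∈ G.neighborFinset u, (((insert u (G.neighborFinset u))ᶜ.card : ℝ) -
      {w ∈ (insert u (G.neighborFinset u))ᶜ | G.Adj a w}.card) ≤ e * G.degree u)
    (hb : (insert u (G.neighborFinset u))ᶜ.card ≤ k - 2) :
    ∃ L : Finset V, L.card = k ∧ (∀ v ∈ L, 0 < x v) ∧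
      ∀ v, v ∉ L → ∀ w, w ∉ L → ¬ G.Adj v w := by
  have hk' : (3 : ℝ) ≤ k := by exact_mod_cast hk
  have hn' : (110 * k ^ 2 : ℝ) ≤ n := by exact_mod_cast hn
  have hnk : (330 * k : ℝ) ≤ n := by nlinarith
  have hnk' : 330 * k ≤ n := by exact_mod_cast hnk
  set A := G.neighborFinset u with hA
  set B := (insert u A)ᶜ with hB
  set d := G.degree u with hd
  have hAcard : A.card = d := card_neighborFinset_eq_degree G u
  have huA : u ∉ A := by simp [hA]
  have hdn : d + B.card + 1 = n := by
    have h1 := Finset.card_compl_add_card (insert u A)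
    rw [Finset.card_insert_of_notMem huA, hAcard, hV] at h1
    change B.card + _ = n at h1
    omega
  set L : Finset V := Finset.univ.filter (fun v => n + 2 * k + 1 ≤ 2 * G.degree v) with hLdef
  have hLmem : ∀ v, v ∈ L ↔ n + 2 * k + 1 ≤ 2 * G.degree v := fun v => by simp [hLdef]
  have hLdeg : ∀ v ∈ L, Fintype.card V + 2 * k + 1 ≤ 2 * G.degree v := fun v hv => by
    rw [hV]; exact (hLmem v).1 hv
  have huL : u ∈ L := by rw [hLmem]; omega
  -- non-neighbours of `u` are adjacent to most neighbours of `u`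
  have hBL : ∀ w ∈ B, w ∈ L := by
    intro w hw
    have h1 : ∑ a ∈ A, {w ∈ B | G.Adj a w}.card = ∑ w ∈ B, {a ∈ A | G.Adj a w}.card :=
      Finset.sum_card_bipartiteAbove_eq_sum_card_bipartiteBelow _
    have h2 : ∑ w ∈ B, ((d : ℝ) - {a ∈ A | G.Adj a w}.card) ≤ e * d := by
      refine le_trans (le_of_eq ?_) hβ
      rw [Finset.sum_sub_distrib, Finset.sum_sub_distrib, Finset.sum_const, Finset.sum_const,
        hAcard, nsmul_eq_mul, nsmul_eq_mul, mul_comm]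
      congr 1
      exact_mod_cast h1.symm
    have h3 : (d : ℝ) - {a ∈ A | G.Adj a w}.card ≤ e * d := by
      refine le_trans ?_ h2
      refine Finset.single_le_sum (f := fun w => (d : ℝ) - {a ∈ A | G.Adj a w}.card) ?_ hw
      intro i _
      rw [sub_nonneg, ← hAcard]
      exact_mod_cast Finset.card_filter_le _ _
    have h4 : {a ∈ A | G.Adj a w}.card ≤ G.degree w := by
      rw [← card_neighborFinset_eq_degree]
      refine Finset.card_le_card fun a ha => ?_
      rw [mem_neighborFinset]
      exact (Finset.mem_filter.1 ha).2.symm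
    have h5 : ({a ∈ A | G.Adj a w}.card : ℝ) ≤ G.degree w := by exact_mod_cast h4
    have h6 : (n : ℝ) ≤ d + k := by exact_mod_cast (by omega : n ≤ d + k)
    have h7 : 55 * (e * d) ≤ d := by nlinarith
    rw [hLmem]
    have : (n + 2 * k + 1 : ℝ) ≤ 2 * G.degree w := by linarith
    exact_mod_cast this
  have hadjL : ∀ v, v ∉ L → G.Adj u v := by
    intro v hv
    by_contra h
    refine hv (hBL v ?_)
    rw [hB, Finset.mem_compl, Finset.mem_insert, not_or, hA, mem_neighborFinset]
    exact ⟨fun h => hv (h ▸ huL), h⟩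
  have hdeg : ∑ v ∈ Lᶜ, G.degree v ≤ (3 * k - 3) * n := by
    have h1 : Lᶜ ⊆ A := fun v hv => by
      rw [hA, mem_neighborFinset]
      exact hadjL v (Finset.mem_compl.1 hv)
    refine (Finset.sum_le_sum_of_subset h1).trans ?_
    have h2 : ∀ a ∈ A, G.degree a ≤ (k - 1) + {w ∈ A | G.Adj a w}.card := by
      intro a ha
      have h3 := degree_eq_of_adj G ((G.mem_neighborFinset u a).1 ha)
      have h4 : {w ∈ B | G.Adj a w}.card ≤ B.card := Finset.card_filter_le _ _
      change G.degree a = 1 + {w ∈ A | G.Adj a w}.card + {w ∈ B | G.Adj a w}.card at h3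
      omega
    refine (Finset.sum_le_sum h2).trans ?_
    rw [Finset.sum_add_distrib, Finset.sum_const, hAcard, smul_eq_mul]
    have h3 := sum_degree_within_neighbors_le G (by omega) hG (le_refl A)
    rw [hAcard] at h3
    calc _ ≤ d * (k - 1) + (2 * k - 2) * d := Nat.add_le_add_left h3 _
      _ = (3 * k - 3) * d := by
        have h5 : 3 * k - 3 = (k - 1) + (2 * k - 2) := by omega
        rw [h5]; ring
      _ ≤ _ := Nat.mul_le_mul_left _ (by omega)
  have hweight := weight_le_of_subinvariant G hk hn hV he hq hx hsub
    (fun v hv => by rw [hLmem] at hv; omega) hdeg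
  set S := ∑ v, x v with hS
  set T := ∑ v ∈ L, x v with hT
  have hloc : ∀ v, (q + 1 - G.degree v) * x v ≤ S := by
    intro v
    have h1 : ∑ w ∈ insert v (G.neighborFinset v), x w ≤ S :=
      Finset.sum_le_sum_of_subset_of_nonneg (Finset.subset_univ _) fun w _ _ => hx w
    rw [Finset.sum_insert (by simp)] at h1
    have := hsub v
    linarith
  have hSlow : 2 * k - e ≤ S := by
    obtain ⟨v, hv⟩ := hxmax
    have h1 := hloc v
    rw [hv, mul_one] at h1
    have h2 := G.degree_lt_card_verts v
    rw [hV] at h2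
    have h3 : (G.degree v : ℝ) + 1 ≤ n := by exact_mod_cast h2
    linarith
  have hTlow : k - 1 / 10 ≤ T := by
    have h1 : (2 * k - e) * (n - 10 * k) ≤ S * (n - 10 * k) :=
      mul_le_mul_of_nonneg_right hSlow (by linarith)
    have h2 : (2 * n) * (k - 1 / 10) ≤ 2 * n * T := by
      have : 0 ≤ k * e := by positivity
      nlinarith
    exact le_of_mul_le_mul_left h2 (by linarith)
  have hTcard : T ≤ L.card := by
    have := Finset.sum_le_card_nsmul L x 1 fun v _ => hx1 v
    simpa using this
  have hcard : L.card = k := by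
    apply le_antisymm
    · by_contra! hlt
      by_cases hadj : ∃ c ∈ L, ∃ c' ∈ L, G.Adj c c'
      · obtain ⟨c, hc, c', hc', h⟩ := hadj
        exact hG (cycleGraph_isContained_of_large_degree G (by omega) hLdeg hlt hc hc' h)
      · push Not at hadj
        have h1 : L ⊆ insert u B := by
          intro v hv
          by_cases hvu : v = u
          · simp [hvu]
          · refine Finset.mem_insert_of_mem ?_
            rw [hB, Finset.mem_compl, Finset.mem_insert, not_or, hA, mem_neighborFinset]
            exact ⟨hvu, hadj u huL v hv⟩
        have h2 := (Finset.card_le_card h1).trans (Finset.card_insert_le _ _)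
        omega
    · by_contra! hlt
      have : (L.card : ℝ) + 1 ≤ k := by exact_mod_cast hlt
      linarith
  have hTsplit : ∀ v ∈ L, T ≤ x v + (k - 1) := by
    intro v hv
    rw [hT, ← Finset.add_sum_erase L x hv]
    have := Finset.sum_le_card_nsmul (L.erase v) x 1 fun v _ => hx1 v
    rw [Finset.card_erase_of_mem hv, hcard, nsmul_eq_mul, Nat.cast_sub (by omega)] at this
    push_cast at this
    linarith
  refine ⟨L, hcard, fun v hv => ?_, ?_⟩
  · have := hTsplit v hv
    linarith
  -- an edge `r r'` off `L` forces `r` to miss every vertex of `L` except `u`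
  intro r hr r' hr' hrr
  have hmiss : ∀ c ∈ L.erase u, ¬ G.Adj r c := by
    intro c hc hrc
    rw [Finset.mem_erase] at hc
    exact hG (cycleGraph_isContained_of_edge_outside G hLdeg hcard hc.2 huL hc.1 hr hr' hrc
      (hadjL r' hr').symm hrr)
  have hSup : S ≤ 2 * k + 1 / 5 := by
    have h1 : T ≤ k := by rwa [hcard] at hTcard
    have h2 : 2 * n * T ≤ 2 * n * k := mul_le_mul_of_nonneg_left h1 (by positivity)
    have h3 : S * (n - 10 * k) ≤ (2 * k + 1 / 5) * (n - 10 * k) := by nlinarith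
    exact le_of_mul_le_mul_right h3 (by linarith)
  -- these vertices of `L` then weigh too little
  have hsmall : ∀ c ∈ L.erase u, x c ≤ 1 - 3 / (10 * k) := by
    intro c hc
    have h1 : G.degree c + 2 ≤ n := by
      have h2 : G.neighborFinset c ⊆ (Finset.univ.erase c).erase r := by
        intro w hw
        rw [mem_neighborFinset] at hw
        refine Finset.mem_erase.2 ⟨?_, Finset.mem_erase.2 ⟨hw.ne', Finset.mem_univ _⟩⟩
        rintro rfl
        exact hmiss c hc hw.symm
      have h3 := Finset.card_le_card h2
      rw [card_neighborFinset_eq_degree, Finset.card_erase_of_mem, Finset.card_erase_of_mem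
        (Finset.mem_univ c), Finset.card_univ, hV] at h3
      · omega
      · refine Finset.mem_erase.2 ⟨?_, Finset.mem_univ _⟩
        rintro rfl
        exact hr (Finset.mem_of_mem_erase hc)
    have h2 : (G.degree c : ℝ) + 2 ≤ n := by exact_mod_cast h1
    have h3 : (2 * k + 1 - e) * x c ≤ 2 * k + 1 / 5 := by
      refine le_trans (mul_le_mul_of_nonneg_right ?_ (hx c)) ((hloc c).trans hSup)
      linarith
    have h4 : 2 * k + 1 / 5 ≤ (2 * k + 1 - e) * (1 - 3 / (10 * k)) := by
      have h5 : (3 : ℝ) / (10 * k) * k = 3 / 10 := by field_simp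
      have h6 : (3 : ℝ) / (10 * k) ≤ 1 / 10 := by
        rw [div_le_iff₀ (by linarith)]; linarith
      have h7 : (0 : ℝ) ≤ 3 / (10 * k) := by positivity
      nlinarith
    exact le_of_mul_le_mul_left (h3.trans h4) (by linarith)
  have h1 := Finset.sum_le_card_nsmul (L.erase u) x _ hsmall
  rw [Finset.card_erase_of_mem huL, hcard, nsmul_eq_mul, Nat.cast_sub (by omega)] at h1
  have h2 : T = x u + ∑ v ∈ L.erase u, x v := (Finset.add_sum_erase L x huL).symm
  have h3 := hx1 u
  have h5 : (3 : ℝ) / (10 * k) * k = 3 / 10 := by field_simp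
  have h6 : (3 : ℝ) / (10 * k) ≤ 1 / 10 := by
    rw [div_le_iff₀ (by linarith)]; linarith
  push_cast at h1
  nlinarith

end SimpleGraph

theorem theorem2 {V : Type*} [Fintype V] (k n : ℕ) (hk : 3 ≤ k) (hn : 110 * k ^ 2 ≤ n)
    (G : SimpleGraph V) (hV : Fintype.card V = n)
    (hG : (SimpleGraph.cycleGraph (2 * k + 1)).Free G)
    (hne : ¬ Nonempty (SimpleGraph.Iso G (completeSplitGraph n k))) :
    G.qIndex < (completeSplitGraph n k).qIndex := by
  classical
  by_contra! hle
  have hk' : (3 : ℝ) ≤ k := by exact_mod_cast hk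
  have hn' : (110 * k ^ 2 : ℝ) ≤ n := by exact_mod_cast hn
  have hkn : k < n := by nlinarith
  have hn0 : (0 : ℝ) < n := by nlinarith
  have hVne : Nonempty V := Fintype.card_pos_iff.1 (by omega)
  obtain ⟨q₀, hroot, hnq, hq₀⟩ :=
    SimpleGraph.exists_root_le_qIndex_completeSplitGraph (by omega : 1 ≤ k) hkn
  have hq : q₀ ≤ G.qIndex := hq₀.trans hle
  obtain ⟨x, hx, hx1, hxmax, hsub⟩ := G.exists_subinvariant (by linarith)
  -- `e` is the amount by which `q₀` falls short of `n + 2k - 2`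
  obtain ⟨e, he_def⟩ : ∃ e : ℝ, e = n + 2 * k - 2 - q₀ := ⟨_, rfl⟩
  have hqe : q₀ * e = 2 * k * (k - 1) := by rw [he_def]; linarith
  have he0 : 0 ≤ e := by
    by_contra! h
    nlinarith
  have hen : n * e ≤ 2 * k * (k - 1) := by
    rw [← hqe]
    exact mul_le_mul_of_nonneg_right hnq he0
  have he : 55 * e ≤ 1 := by
    have h1 : (110 * k ^ 2 : ℝ) * e ≤ n * e := mul_le_mul_of_nonneg_right hn' he0
    have h2 : (2 * k ^ 2 : ℝ) * (55 * e) ≤ 2 * k ^ 2 * 1 := by nlinarith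
    exact le_of_mul_le_mul_left h2 (by positivity)
  have hqe' : n + 2 * k - 2 - e ≤ G.qIndex := by linarith
  obtain ⟨u, hd, hu⟩ := G.exists_merris_vertex (by linarith) hx
    (hxmax.imp fun v hv => by rw [hv]; exact one_pos) hsub
  set A := G.neighborFinset u with hA
  set B := (insert u A)ᶜ with hB
  have hAcard : A.card = G.degree u := G.card_neighborFinset_eq_degree u
  have hdn : (G.degree u : ℝ) + B.card + 1 = n := by
    have h1 := Finset.card_compl_add_card (insert u A)
    rw [Finset.card_insert_of_notMem (by simp [hA]), hAcard, hV] at h1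
    change B.card + _ = n at h1
    exact_mod_cast (by omega : G.degree u + B.card + 1 = n)
  have hd' : (0 : ℝ) < G.degree u := by exact_mod_cast hd
  have hEG : ∑ a ∈ A, ({w ∈ A | G.Adj a w}.card : ℝ) ≤ (2 * k - 2) * G.degree u := by
    have h1 := SimpleGraph.sum_degree_within_neighbors_le G (by omega) hG (le_refl A)
    rw [hAcard] at h1
    have : ((2 * k - 2 : ℕ) : ℝ) = 2 * k - 2 := by
      rw [Nat.cast_sub (by omega)]; push_cast; ring
    rw [← this]
    exact_mod_cast h1
  have hsum : ∑ w ∈ A, (G.degree w : ℝ) = G.degree u +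
      ∑ a ∈ A, ({w ∈ A | G.Adj a w}.card : ℝ) + ∑ a ∈ A, ({w ∈ B | G.Adj a w}.card : ℝ) := by
    rw [← hAcard, Finset.card_eq_sum_ones]
    push_cast
    rw [← Finset.sum_add_distrib, ← Finset.sum_add_distrib]
    refine Finset.sum_congr rfl fun a ha => ?_
    have := SimpleGraph.degree_eq_of_adj G ((G.mem_neighborFinset u a).1 ha)
    exact_mod_cast this
  have hmiss : ∑ a ∈ A, ((B.card : ℝ) - {w ∈ B | G.Adj a w}.card) =
      G.degree u * B.card - ∑ a ∈ A, ({w ∈ B | G.Adj a w}.card : ℝ) := by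
    rw [Finset.sum_sub_distrib, Finset.sum_const, hAcard, nsmul_eq_mul]
  have hmiss0 : 0 ≤ ∑ a ∈ A, ((B.card : ℝ) - {w ∈ B | G.Adj a w}.card) :=
    Finset.sum_nonneg fun a _ => by
      rw [sub_nonneg]
      exact_mod_cast Finset.card_filter_le _ _
  -- Merris's inequality, with the two deficits on the right
  have hmain : (2 * k - 2 - e) * G.degree u +
      ∑ a ∈ A, ((B.card : ℝ) - {w ∈ B | G.Adj a w}.card) ≤
        ∑ a ∈ A, ({w ∈ A | G.Adj a w}.card : ℝ) := by
    have h1 := mul_le_mul_of_nonneg_right hqe' hd'.le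
    rw [hsum] at hu
    rw [hmiss]
    rw [← hdn] at h1
    linarith
  by_cases hb : k - 1 ≤ B.card
  · exact hG (SimpleGraph.cycleGraph_isContained_of_many_nonneighbors G hk he hd
      (by linarith) (by linarith) hb)
  · obtain ⟨L, hL, hxL, hind⟩ := SimpleGraph.exists_cover_of_few_nonneighbors G hk hn hV hG he0 he
      hen hqe' hx hx1 hxmax hsub (u := u) (by linarith) (by change B.card ≤ _; omega)
    exact hne (SimpleGraph.nonempty_iso_completeSplitGraph hV hL
      (SimpleGraph.dominating_of_subinvariant G (by omega) hkn hV hroot hnq hq hx hsub hL hxL hind)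
      hind)
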